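/- Corollary 3.3 (Liouville's Theorem). Let $K$ be a simplicial 2-complex without boundary given by a triangulation of a domain in $\mathbb{C}$ (more generally, a triangulation without boundary of a connected oriented surface), oriented by the orientation of the domain. A *circle packing* for $K$ is a family $P=(C_P(v))_{v\in K^0}$ of circles in $\mathbb{C}$, indexed by the vertices of $K$, such that $C_P(u),C_P(v),C_P(w)$ is a positively oriented triple of mutually externally tangent circles whenever $\langle u,v,w\rangle$ is a positively oriented face of $K$; let $r_P(v)>0$ be the radius of $C_P(v)$. Let $S_P:K\to\mathbb{C}$ be the map of the geometric complex $K$ that sends each vertex $v$ to the center of $C_P(v)$ and is affine on edges and faces. The *carrier* of $P$ is $S_P(K)$, and $P$ is *univalent* if its circles have mutually disjoint interiors. For circle packings $P,Q$ for $K$, the *cp-map* $f$ with domain packing $P$ and range packing $Q$ sends the center of $C_P(v)$ to the center of $C_Q(v)$ for every vertex $v$ and is affine on the faces of the carrier of $P$; the associated *ratio map* $f^\#$ takes the value $r_Q(v)/r_P(v)$ at the center of $C_P(v)$ and is affine on the edges and faces of the carrier of $P$. (Both maps are regarded as functions on the geometric complex $K$, which for univalent $P$ is identified with the carrier through $S_P$.)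 Suppose that $P$ is a univalent circle packing for $K$ whose carrier is all of $\mathbb{C}$, and that the 1-skeleton of $K$ is recurrent, that is, the simple random walk on it, started at any vertex, visits every vertex infinitely many times with probability $1$. Then for every cp-map $f$ with domain packing $P$ (that is, for every circle packing $Q$ for $K$, branched or not), the ratio map $f^\#$ is either unbounded or constant. -/

import Mathlib

open MeasureTheory ProbabilityTheory Filter

/-- A triangulation (simplicial 2-complex) without boundary of a connected oriented surface, with
vertex set `V`. It is given by its positively oriented faces; every vertex and every edge lies in
a face, so these determine the complex. Every triangulation without boundary of a domain in `ℂ`,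
with the orientation induced from `ℂ`, is of this form. -/
structure OrientedTriangulation (V : Type*) where
  /-- `pos u v w` means that `⟨u, v, w⟩` is a face and the triple `(u, v, w)` is positively
  oriented. -/
  pos : V → V → V → Prop
  pos_rotate : ∀ u v w, pos u v w → pos v w u
  /-- The link of every vertex is a simplicial cycle `c 0, c 1, …, c (n - 1)` (so there are
  finitely many faces at each vertex), listed in the positive direction. -/
  link_cycle : ∀ v, ∃ n : ℕ, 3 ≤ n ∧ ∃ c : ZMod n → V, Function.Injective c ∧
    ∀ w x, pos v w x ↔ ∃ i, w = c i ∧ x = c (i + 1)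
  /-- The surface is connected: any two vertices are joined by an edge path. -/
  connected : ∀ u v, Relation.ReflTransGen (fun a b => ∃ x, pos a b x) u v

namespace OrientedTriangulation

variable {V : Type*}

theorem pos_pred (K : OrientedTriangulation V) {u v w : V} (h : K.pos u v w) :
    ∃ x, K.pos v u x := by
  obtain ⟨n, -, c, -, hcyc⟩ := K.link_cycle u
  obtain ⟨i, hv, -⟩ := (hcyc v w).1 h
  refine ⟨c (i - 1), K.pos_rotate _ _ _ ((hcyc (c (i - 1)) v).2 ⟨i - 1, rfl, ?_⟩) |>
    K.pos_rotate _ _ _⟩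
  rw [hv, sub_add_cancel]

theorem pos_ne (K : OrientedTriangulation V) {u v w : V} (h : K.pos u v w) : v ≠ w := by
  obtain ⟨n, hn, c, hc, hcyc⟩ := K.link_cycle u
  obtain ⟨i, rfl, rfl⟩ := (hcyc v w).1 h
  have : Fact (1 < n) := ⟨by omega⟩
  intro h
  simpa using hc h

/-- The 1-skeleton of the triangulation. -/
def skeleton (K : OrientedTriangulation V) : SimpleGraph V where
  Adj u v := ∃ w, K.pos u v w
  symm := ⟨fun _ _ ⟨_, h⟩ => K.pos_pred h⟩
  loopless := ⟨fun _ ⟨_, h⟩ => K.pos_ne (K.pos_rotate _ _ _ (K.pos_rotate _ _ _ h)) rfl⟩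

theorem neighborSet_finite (K : OrientedTriangulation V) (v : V) :
    (K.skeleton.neighborSet v).Finite := by
  obtain ⟨n, hn, c, -, hcyc⟩ := K.link_cycle v
  have : NeZero n := ⟨by omega⟩
  refine (Set.finite_range c).subset ?_
  rintro w ⟨x, h⟩
  obtain ⟨i, rfl, -⟩ := (hcyc w x).1 h
  exact ⟨i, rfl⟩

theorem neighborSet_nonempty (K : OrientedTriangulation V) (v : V) :
    (K.skeleton.neighborSet v).Nonempty := by
  obtain ⟨n, -, c, -, hcyc⟩ := K.link_cycle v
  exact ⟨c 0, c (0 + 1), (hcyc _ _).2 ⟨0, rfl, rfl⟩⟩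

section Walk

variable [MeasurableSpace V] [DiscreteMeasurableSpace V]

/-- One step of the simple random walk on the 1-skeleton: from `v`, jump to a neighbour of `v`
chosen uniformly at random. -/
noncomputable def step (K : OrientedTriangulation V) : Kernel V V where
  toFun v := uniformOn (K.skeleton.neighborSet v)
  measurable' := Measurable.of_discrete

instance (K : OrientedTriangulation V) : IsMarkovKernel K.step :=
  ⟨fun v => isProbabilityMeasure_uniformOn (K.neighborSet_finite v) (K.neighborSet_nonempty v)⟩

/-- The law, on the space `ℕ → V` of trajectories, of the simple random walk on the 1-skeleton
started at `v`. -/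
noncomputable def walk (K : OrientedTriangulation V) (v : V) : Measure (ℕ → V) :=
  Kernel.traj (X := fun _ => V)
    (fun n => K.step.comap (fun x : (i : Finset.Iic n) → V => x ⟨n, Finset.mem_Iic.2 le_rfl⟩)
      (measurable_pi_apply _)) 0 (fun _ => v)

end Walk

/-- The 1-skeleton is recurrent: from every starting vertex, the simple random walk visits every
vertex infinitely many times with probability one. -/
def Recurrent (K : OrientedTriangulation V) : Prop :=
  letI : MeasurableSpace V := ⊤
  haveI : DiscreteMeasurableSpace V := ⟨fun _ => MeasurableSpace.measurableSet_top⟩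
  ∀ v, ∀ᵐ ω ∂(K.walk v), ∀ w, ∃ᶠ n in atTop, ω n = w

/-- The geometric realization of the triangulation: the points given by nonnegative barycentric
coordinates of sum one that are supported in a face. -/
def Realization (K : OrientedTriangulation V) : Type _ :=
  {t : V →₀ ℝ // (∀ v, 0 ≤ t v) ∧ (t.sum fun _ a => a) = 1 ∧
    ∃ u v w, K.pos u v w ∧ (t.support : Set V) ⊆ {u, v, w}}

end OrientedTriangulation

/-- A circle packing for `K`: a family of circles indexed by the vertices such that positively
oriented faces correspond to positively oriented triples of mutually externally tangent circles.
Circles of different vertices may overlap or coincide (branched packings are allowed). -/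
structure CirclePacking {V : Type*} (K : OrientedTriangulation V) where
  center : V → ℂ
  radius : V → ℝ
  radius_pos : ∀ v, 0 < radius v
  /-- As `K.pos` is invariant under rotation, this covers all three pairs of circles of a face. -/
  tangent : ∀ u v w, K.pos u v w → dist (center u) (center v) = radius u + radius v
  /-- The centers of a positively oriented face are in counterclockwise order. -/
  oriented : ∀ u v w, K.pos u v w →
    0 < ((starRingEnd ℂ) (center v - center u) * (center w - center u)).im

namespace CirclePacking

variable {V : Type*} {K : OrientedTriangulation V}

/-- The packing is univalent: its circles have mutually disjoint interiors. -/
def Univalent (P : CirclePacking K) : Prop :=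
  ∀ u v, u ≠ v →
    Disjoint (Metric.ball (P.center u) (P.radius u)) (Metric.ball (P.center v) (P.radius v))

/-- The map from the geometric realization to the plane which sends each vertex `v` to the center
of its circle and is affine on edges and faces. -/
noncomputable def place (P : CirclePacking K) (x : K.Realization) : ℂ :=
  x.1.sum fun v a => (a : ℂ) * P.center v

/-- The carrier of the packing, as a subset of the plane. -/
def carrier (P : CirclePacking K) : Set ℂ := Set.range P.place

/-- The ratio map from `P` to `Q`, i.e. the ratio map associated with the circle packing map from
`P` to `Q`: its value at a vertex `v` is the ratio of the radius of `v` in `Q` to the radius of `v`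
in `P`, and it is affine on edges and faces. It is regarded as a function on the geometric complex
underlying `P`; for univalent `P` this is the carrier in the plane, through `P.place`. -/
noncomputable def ratioMap (P Q : CirclePacking K) (x : K.Realization) : ℝ :=
  x.1.sum fun v a => a * (Q.radius v / P.radius v)

end CirclePacking

-- Let `t v` be the ratio of the radius of `v` in `Q` to its radius in `P`. The faces around `v`
-- close up in `Q`, so their angles at `v` sum to a positive multiple of `2π`, hence to at least
-- `2π`; in the univalent `P` they sum to at most `2π`. Each angle depends only on three radii, and
-- `mul_faceAngle_sub_le` bounds `t v` times its increase from `P` to `Q` by a linear form in the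
-- differences `t w - t v`, with positive coefficients read off `P`. Summed around `v`, this makes
-- `t` subharmonic for a network on the 1-skeleton (`Univalent.ratio_subharmonic`). Its conductances
-- are symmetric and at most `1`.
--
-- Recurrence forces the Green function of the simple random walk to diverge
-- (`Recurrent.exists_lt_sum`), so normalised truncated Green functions are cutoffs equal to `1` at
-- a given vertex with arbitrarily small Dirichlet energy (`exists_energy_le`). Smaller conductances
-- only lower that energy. The Caccioppoli inequality with these cutoffs makes a bounded nonnegative
-- subharmonic function constant along edges (`eq_of_subharmonic`), and connectedness finishes the
-- proof.

/-- The average of `h` over the finite set `N v`. -/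
noncomputable def neighborAverage {V : Type*} (N : V → Finset V) (h : V → ℝ) (v : V) : ℝ :=
  (∑ w ∈ N v, h w) / (N v).card

theorem neighborAverage_nonneg {V : Type*} (N : V → Finset V) {h : V → ℝ} (hh : ∀ v, 0 ≤ h v)
    (v : V) : 0 ≤ neighborAverage N h v :=
  div_nonneg (Finset.sum_nonneg fun w _ => hh w) (Nat.cast_nonneg _)

theorem iterate_neighborAverage_nonneg {V : Type*} (N : V → Finset V) {h : V → ℝ}
    (hh : ∀ v, 0 ≤ h v) (n : ℕ) (v : V) : 0 ≤ ((neighborAverage N)^[n] h) v := by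
  induction n generalizing v with
  | zero => exact hh v
  | succ n ih =>
    rw [Function.iterate_succ_apply']
    exact neighborAverage_nonneg N ih v

-- Random walk, averaging operator and Green function

namespace OrientedTriangulation

variable {V : Type*}

/-- The finite set of neighbours of a vertex. -/
noncomputable def nbrs (K : OrientedTriangulation V) (v : V) : Finset V :=
  (K.neighborSet_finite v).toFinset

theorem mem_nbrs (K : OrientedTriangulation V) {v w : V} :
    w ∈ K.nbrs v ↔ K.skeleton.Adj v w := by
  simp [nbrs]

theorem mem_nbrs_comm (K : OrientedTriangulation V) {v w : V} :
    w ∈ K.nbrs v ↔ v ∈ K.nbrs w := by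
  rw [mem_nbrs, mem_nbrs, K.skeleton.adj_comm]

theorem card_nbrs_pos (K : OrientedTriangulation V) (v : V) : 0 < (K.nbrs v).card := by
  obtain ⟨w, hw⟩ := K.neighborSet_nonempty v
  exact Finset.card_pos.2 ⟨w, K.mem_nbrs.2 hw⟩

section Walk

variable [MeasurableSpace V] [DiscreteMeasurableSpace V]

theorem lintegral_step (K : OrientedTriangulation V) {h : V → ℝ} (hh : ∀ v, 0 ≤ h v) (v : V) :
    ∫⁻ w, ENNReal.ofReal (h w) ∂K.step v = ENNReal.ofReal (neighborAverage K.nbrs h v) := by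
  have hs : K.skeleton.neighborSet v = (K.nbrs v : Set V) := by simp [nbrs]
  change ∫⁻ w, ENNReal.ofReal (h w) ∂(uniformOn (K.skeleton.neighborSet v)) = _
  rw [uniformOn, ProbabilityTheory.cond, lintegral_smul_measure, hs, lintegral_finset,
    Measure.count_apply_finset, neighborAverage, div_eq_inv_mul,
    ENNReal.ofReal_mul (by positivity), ENNReal.ofReal_inv_of_pos
      (by exact_mod_cast K.card_nbrs_pos v), ENNReal.ofReal_natCast,
    ENNReal.ofReal_sum_of_nonneg fun w _ => hh w]
  simp

theorem lintegral_walk_zero (K : OrientedTriangulation V) (v : V) (h : V → ENNReal) :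
    ∫⁻ ω, h (ω 0) ∂K.walk v = h v := by
  have h0 : ∀ ω : ℕ → V, h (ω 0) = (fun y : (i : Finset.Iic 0) → V =>
    h (y ⟨0, Finset.mem_Iic.2 le_rfl⟩)) (Preorder.frestrictLe 0 ω) := fun _ => rfl
  have hm : Measurable fun y : (i : Finset.Iic 0) → V => h (y ⟨0, Finset.mem_Iic.2 le_rfl⟩) :=
    (Measurable.of_discrete (f := h)).comp (measurable_pi_apply _)
  simp_rw [h0]
  rw [walk, ← lintegral_map hm (by fun_prop), Kernel.traj_map_frestrictLe_apply,
    Kernel.partialTraj_self, Kernel.lintegral_id' hm]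

/-- The Markov property: both integrands depend only on a finite initial segment of the trajectory,
whose law is extended by one step of the kernel. -/
theorem lintegral_walk_succ (K : OrientedTriangulation V) (v : V) (h : V → ENNReal) (n : ℕ) :
    ∫⁻ ω, h (ω (n + 1)) ∂K.walk v = ∫⁻ ω, ∫⁻ w, h w ∂(K.step (ω n)) ∂K.walk v := by
  have h0 : ∀ ω : ℕ → V, h (ω (n + 1)) = (fun y : (i : Finset.Iic (n + 1)) → V =>
    h (y ⟨n + 1, Finset.mem_Iic.2 le_rfl⟩)) (Preorder.frestrictLe (n + 1) ω) := fun _ => rfl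
  have h1 : ∀ ω : ℕ → V, ∫⁻ w, h w ∂(K.step (ω n)) = (fun y : (i : Finset.Iic n) → V =>
    ∫⁻ w, h w ∂(K.step (y ⟨n, Finset.mem_Iic.2 le_rfl⟩))) (Preorder.frestrictLe n ω) :=
    fun _ => rfl
  have hm : Measurable fun y : (i : Finset.Iic (n + 1)) → V =>
      h (y ⟨n + 1, Finset.mem_Iic.2 le_rfl⟩) :=
    (Measurable.of_discrete (f := h)).comp (measurable_pi_apply _)
  have hm1 : Measurable fun y : (i : Finset.Iic n) → V =>
      ∫⁻ w, h w ∂(K.step (y ⟨n, Finset.mem_Iic.2 le_rfl⟩)) :=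
    (Measurable.of_discrete (f := fun u => ∫⁻ w, h w ∂(K.step u))).comp (measurable_pi_apply _)
  simp_rw [h0, h1]
  rw [walk, ← lintegral_map hm (by fun_prop), ← lintegral_map hm1 (by fun_prop),
    Kernel.traj_map_frestrictLe_apply, Kernel.traj_map_frestrictLe_apply,
    Kernel.partialTraj_succ_eq_comp (Nat.zero_le n), Kernel.lintegral_comp _ _ _ hm]
  refine lintegral_congr fun z => ?_
  rw [← lintegral_map (f := h) (g := fun y : (i : Finset.Iic (n + 1)) → V =>
      (y ⟨n + 1, Finset.mem_Iic.2 le_rfl⟩)) .of_discrete (measurable_pi_apply _),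
    ← Kernel.map_apply _ (measurable_pi_apply _), Kernel.map_partialTraj_succ_self]
  rfl

/-- Peeling off the last step replaces `h` by its neighbour average. For `h` the indicator of `o`,
the iterates are the probabilities of being at `o` at time `n`. -/
theorem lintegral_walk (K : OrientedTriangulation V) (v : V) {h : V → ℝ} (hh : ∀ v, 0 ≤ h v)
    (n : ℕ) : ∫⁻ ω, ENNReal.ofReal (h (ω n)) ∂K.walk v =
      ENNReal.ofReal (((neighborAverage K.nbrs)^[n] h) v) := by
  induction n generalizing h with
  | zero => exact K.lintegral_walk_zero v fun w => ENNReal.ofReal (h w)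
  | succ n ih =>
    rw [K.lintegral_walk_succ v fun w => ENNReal.ofReal (h w)]
    simp_rw [K.lintegral_step hh]
    rw [ih (neighborAverage_nonneg _ hh), Function.iterate_succ_apply]

end Walk

open Classical in
/-- On a recurrent triangulation the return probabilities are not summable. -/
theorem Recurrent.exists_lt_sum {K : OrientedTriangulation V} (hK : K.Recurrent) (o : V) (C : ℝ) :
    ∃ n, C < ∑ k ∈ Finset.range n, ((neighborAverage K.nbrs)^[k] (Pi.single o 1)) o := by
  let _ : MeasurableSpace V := ⊤
  have : DiscreteMeasurableSpace V := ⟨fun _ => MeasurableSpace.measurableSet_top⟩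
  have hh : ∀ v, (0 : ℝ) ≤ (Pi.single o (1 : ℝ) : V → ℝ) v := fun v => by
    rw [Pi.single_apply]; split_ifs <;> norm_num
  by_contra! hC
  have hsum : Summable fun k => ((neighborAverage K.nbrs)^[k] (Pi.single o 1)) o :=
    summable_of_sum_range_le (fun k => iterate_neighborAverage_nonneg _ hh k o) hC
  have hmeas : ∀ n, K.walk o {ω | ω n = o} =
      ENNReal.ofReal (((neighborAverage K.nbrs)^[n] (Pi.single o 1)) o) := fun n => by
    rw [← K.lintegral_walk o hh, ← lintegral_indicator_one]
    · refine lintegral_congr fun ω => ?_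
      by_cases h : ω n = o <;> simp [Set.indicator, h]
    · have hn : Measurable fun ω : ℕ → V => ω n := measurable_pi_apply n
      exact hn (MeasurableSet.of_discrete (s := {o}))
  -- Borel–Cantelli: summable return probabilities would make infinitely many returns a null event,
  -- against recurrence.
  have h0 : K.walk o {ω : ℕ → V | ∃ᶠ n in atTop, ω n = o} = 0 := by
    refine measure_setOfPred_frequently_eq_zero (p := fun n (ω : ℕ → V) => ω n = o) ?_
    simp_rw [hmeas]
    exact hsum.tsum_ofReal_ne_top
  have h1 : K.walk o {ω : ℕ → V | ∃ᶠ n in atTop, ω n = o}ᶜ = 0 :=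
    mem_ae_iff.1 ((hK o).mono fun ω hω => hω o)
  have : IsProbabilityMeasure (K.walk o) := by unfold walk; infer_instance
  have h2 : K.walk o Set.univ = 0 := by
    rw [← Set.union_compl_self {ω : ℕ → V | ∃ᶠ n in atTop, ω n = o}]
    exact measure_union_null h0 h1
  simp at h2

end OrientedTriangulation

-- Dirichlet energy and subharmonic functions on networks

section Network

variable {V : Type*}

/-- Summation by parts, obtained by averaging the sum with its copy under `v ↔ w`. The factor `2`
reflects that each edge is counted in both directions. -/
theorem two_mul_sum_mul_sub (B : Finset V) {a : V → V → ℝ} (ha : ∀ v w, a v w = a w v)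
    (g h : V → ℝ) :
    2 * ∑ v ∈ B, ∑ w ∈ B, a v w * (g v * (h w - h v)) =
      -∑ v ∈ B, ∑ w ∈ B, a v w * ((g w - g v) * (h w - h v)) := by
  have hswap : ∑ v ∈ B, ∑ w ∈ B, a v w * (g v * (h w - h v)) =
      ∑ v ∈ B, ∑ w ∈ B, a v w * (g w * (h v - h w)) := by
    rw [Finset.sum_comm]
    refine Finset.sum_congr rfl fun v _ => Finset.sum_congr rfl fun w _ => ?_
    rw [ha]
  rw [two_mul]
  nth_rewrite 2 [hswap]
  simp only [← Finset.sum_add_distrib, ← Finset.sum_neg_distrib]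
  refine Finset.sum_congr rfl fun v _ => Finset.sum_congr rfl fun w _ => ?_
  ring

/-- Write `q²t - p²s` as `(p²+q²)(t-s)/2 + (q²-p²)(s+t)/2`. Completing a square absorbs the cross
term, using `(p+q)² ≤ 2(p²+q²)` and `s + t ≤ 2M`. -/
theorem caccioppoli_pointwise {p q s t M : ℝ} (hs : 0 ≤ s) (ht : 0 ≤ t) (hsM : s ≤ M)
    (htM : t ≤ M) :
    (p ^ 2 + q ^ 2) / 4 * (t - s) ^ 2 - 2 * M ^ 2 * (q - p) ^ 2 ≤
      (q ^ 2 * t - p ^ 2 * s) * (t - s) := by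
  have h1 : 0 ≤ M - (s + t) / 2 := by linarith
  have h2 : 0 ≤ M + (s + t) / 2 := by linarith
  have h3 := mul_nonneg (mul_nonneg h1 h2) (sq_nonneg (q - p))
  nlinarith [sq_nonneg ((p + q) * (t - s) + 2 * (q - p) * (s + t)),
    mul_nonneg (sq_nonneg (p - q)) (sq_nonneg (t - s))]

/-- The Caccioppoli inequality for a nonnegative bounded subharmonic function `t` on a network and
a cutoff function `φ`. -/
theorem caccioppoli (B : Finset V) {a : V → V → ℝ} (ha : ∀ v w, a v w = a w v)
    (ha0 : ∀ v w, 0 ≤ a v w) {t φ : V → ℝ} {M : ℝ} (ht : ∀ v, 0 ≤ t v) (htM : ∀ v, t v ≤ M)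
    (hsub : ∀ v ∈ B, φ v ≠ 0 → 0 ≤ ∑ w ∈ B, a v w * (t w - t v)) :
    ∑ v ∈ B, ∑ w ∈ B, a v w * ((φ v ^ 2 + φ w ^ 2) * (t w - t v) ^ 2) ≤
      8 * M ^ 2 * ∑ v ∈ B, ∑ w ∈ B, a v w * (φ w - φ v) ^ 2 := by
  -- Test subharmonicity against `φ² t`, which is nonnegative and vanishes where subharmonicity is
  -- not assumed.
  have h1 : 0 ≤ ∑ v ∈ B, ∑ w ∈ B, a v w * ((φ v ^ 2 * t v) * (t w - t v)) := by
    refine Finset.sum_nonneg fun v hv => ?_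
    have : ∑ w ∈ B, a v w * ((φ v ^ 2 * t v) * (t w - t v)) =
        (φ v ^ 2 * t v) * ∑ w ∈ B, a v w * (t w - t v) := by
      rw [Finset.mul_sum]
      exact Finset.sum_congr rfl fun w _ => by ring
    rw [this]
    by_cases h : φ v = 0
    · simp [h]
    · exact mul_nonneg (mul_nonneg (sq_nonneg _) (ht v)) (hsub v hv h)
  have h2 := two_mul_sum_mul_sub B ha (fun v => φ v ^ 2 * t v) t
  have h3 : ∑ v ∈ B, ∑ w ∈ B, a v w * ((φ v ^ 2 + φ w ^ 2) / 4 * (t w - t v) ^ 2 -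
        2 * M ^ 2 * (φ w - φ v) ^ 2) ≤
      ∑ v ∈ B, ∑ w ∈ B, a v w * ((φ w ^ 2 * t w - φ v ^ 2 * t v) * (t w - t v)) :=
    Finset.sum_le_sum fun v _ => Finset.sum_le_sum fun w _ =>
      mul_le_mul_of_nonneg_left
        (caccioppoli_pointwise (ht v) (ht w) (htM v) (htM w)) (ha0 v w)
  have h4 : ∑ v ∈ B, ∑ w ∈ B, a v w * ((φ v ^ 2 + φ w ^ 2) / 4 * (t w - t v) ^ 2 -
        2 * M ^ 2 * (φ w - φ v) ^ 2) =
      (∑ v ∈ B, ∑ w ∈ B, a v w * ((φ v ^ 2 + φ w ^ 2) * (t w - t v) ^ 2)) / 4 -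
      2 * M ^ 2 * ∑ v ∈ B, ∑ w ∈ B, a v w * (φ w - φ v) ^ 2 := by
    simp only [Finset.mul_sum, Finset.sum_div, ← Finset.sum_sub_distrib]
    refine Finset.sum_congr rfl fun v _ => Finset.sum_congr rfl fun w _ => ?_
    ring
  linarith

variable {N : V → Finset V}

theorem finite_support_neighborAverage (hN : ∀ v w, w ∈ N v ↔ v ∈ N w) {h : V → ℝ}
    (hh : (Function.support h).Finite) : (Function.support (neighborAverage N h)).Finite := by
  refine (hh.biUnion fun w _ => (N w).finite_toSet).subset fun v hv => ?_
  by_contra hv'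
  refine hv ?_
  rw [neighborAverage, Finset.sum_eq_zero, zero_div]
  intro w hw
  by_contra hw'
  exact hv' (Set.mem_biUnion (x := w) hw' ((hN v w).1 hw))

theorem finite_support_iterate_neighborAverage (hN : ∀ v w, w ∈ N v ↔ v ∈ N w) {h : V → ℝ}
    (hh : (Function.support h).Finite) (n : ℕ) :
    (Function.support ((neighborAverage N)^[n] h)).Finite := by
  induction n with
  | zero => exact hh
  | succ n ih =>
    rw [Function.iterate_succ_apply']
    exact finite_support_neighborAverage hN ih

open Classical in
/-- If the Green function of the simple random walk diverges at `o`, there are finitely supported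
functions of arbitrarily small Dirichlet energy with value `1` at `o`. -/
theorem exists_energy_le (hN : ∀ v w, w ∈ N v ↔ v ∈ N w) (hpos : ∀ v, 0 < (N v).card) (o : V)
    (hrec : ∀ C : ℝ, ∃ n, C < ∑ k ∈ Finset.range n,
      ((neighborAverage N)^[k] (Pi.single o 1)) o) {ε : ℝ} (hε : 0 < ε) :
    ∃ φ : V → ℝ, (Function.support φ).Finite ∧ φ o = 1 ∧
      ∀ B : Finset V, (∀ v, φ v ≠ 0 → v ∈ B ∧ N v ⊆ B) →
        ∑ v ∈ B, ∑ w ∈ B, (if w ∈ N v then 1 else 0) * (φ w - φ v) ^ 2 ≤ ε := by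
  -- The truncated Green function `f` will have energy at most `2 deg(o) f(o)`; after division by
  -- `f(o)` this is `2 deg(o) / f(o)`, which the threshold makes less than `ε`.
  obtain ⟨n, hn⟩ := hrec (2 * (N o).card / ε)
  set e : V → ℝ := Pi.single o 1 with he
  have he0 : ∀ v, 0 ≤ e v := fun v => by
    rw [he, Pi.single_apply]; split_ifs <;> norm_num
  have hesupp : (Function.support e).Finite :=
    (Set.finite_singleton o).subset Pi.support_single_subset
  set f : V → ℝ := fun v => ∑ k ∈ Finset.range n, ((neighborAverage N)^[k] e) v with hf
  have hfo : 2 * (N o).card / ε < f o := hn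
  have hfo0 : 0 < f o := lt_of_le_of_lt (by positivity) hfo
  have hf0 : ∀ v, 0 ≤ f v := fun v =>
    Finset.sum_nonneg fun k _ => iterate_neighborAverage_nonneg N he0 k v
  have hfsupp : (Function.support f).Finite := by
    refine ((Finset.range n).finite_toSet.biUnion fun k _ =>
      finite_support_iterate_neighborAverage hN hesupp k).subset fun v hv => ?_
    obtain ⟨k, hk, hk'⟩ := Finset.exists_ne_zero_of_sum_ne_zero hv
    exact Set.mem_biUnion (x := k) hk hk'
  -- Telescoping: `f` minus its average is `e` minus the `n`-th iterate, which is nonnegative.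
  have hlap : ∀ v, f v - neighborAverage N f v ≤ e v := by
    intro v
    have : neighborAverage N f v =
        ∑ k ∈ Finset.range n, ((neighborAverage N)^[k + 1] e) v := by
      simp only [Function.iterate_succ_apply', neighborAverage, hf, ← Finset.sum_div]
      rw [Finset.sum_comm]
    rw [this, hf, ← Finset.sum_sub_distrib,
      Finset.sum_range_sub' (fun k => ((neighborAverage N)^[k] e) v)]
    have := iterate_neighborAverage_nonneg N he0 n v
    simpa using this
  refine ⟨fun v => f v / f o, hfsupp.subset fun v hv h => hv (by simp [h]),
    div_self hfo0.ne', fun B hB => ?_⟩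
  have hB' : ∀ v, f v ≠ 0 → v ∈ B ∧ N v ⊆ B := fun v hv => hB v (div_ne_zero hv hfo0.ne')
  have hgreen := two_mul_sum_mul_sub B (a := fun v w => if w ∈ N v then (1 : ℝ) else 0)
    (fun v w => by simp only [hN v w]) f f
  -- By `hlap`, only the vertex `o` can contribute positively. For `f v ≠ 0`, all neighbours of `v`
  -- lie in `B`, so the inner sum is the full graph Laplacian.
  have hle : ∑ v ∈ B, ∑ w ∈ B, (if w ∈ N v then (1 : ℝ) else 0) * (f v * (f v - f w)) ≤
      (N o).card * f o := by
    have hterm : ∀ v ∈ B, ∑ w ∈ B, (if w ∈ N v then (1 : ℝ) else 0) * (f v * (f v - f w)) ≤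
        if v = o then (N o).card * f o else 0 := by
      intro v _
      by_cases hv : f v = 0
      · simp only [hv, zero_mul, mul_zero, Finset.sum_const_zero]
        split_ifs
        · positivity
        · exact le_rfl
      · have hsum : ∑ w ∈ B, (if w ∈ N v then (1 : ℝ) else 0) * (f v * (f v - f w)) =
            f v * ((N v).card * (f v - neighborAverage N f v)) := by
          have hc : ((N v).card : ℝ) ≠ 0 := by exact_mod_cast (hpos v).ne'
          simp only [ite_mul, one_mul, zero_mul]
          rw [← Finset.sum_filter, Finset.filter_mem_eq_inter,
            Finset.inter_eq_right.2 (hB' v hv).2, ← Finset.mul_sum, Finset.sum_sub_distrib,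
            Finset.sum_const, nsmul_eq_mul, neighborAverage]
          field_simp
        have hb : f v * ((N v).card * (f v - neighborAverage N f v)) ≤
            f v * ((N v).card * e v) := by
          have := hlap v
          have := hf0 v
          gcongr
        rw [hsum]
        refine hb.trans ?_
        by_cases hvo : v = o
        · subst hvo
          simp [he, mul_comm]
        · simp [he, hvo]
    refine (Finset.sum_le_sum hterm).trans ?_
    rw [Finset.sum_ite_eq' B o, if_pos (hB' o hfo0.ne').1]
  have hneg : ∑ v ∈ B, ∑ w ∈ B, (if w ∈ N v then (1 : ℝ) else 0) * (f v * (f v - f w)) =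
      -∑ v ∈ B, ∑ w ∈ B, (if w ∈ N v then (1 : ℝ) else 0) * (f v * (f w - f v)) := by
    simp only [← Finset.sum_neg_distrib]
    refine Finset.sum_congr rfl fun v _ => Finset.sum_congr rfl fun w _ => ?_
    ring
  have hscale : ∑ v ∈ B, ∑ w ∈ B, (if w ∈ N v then (1 : ℝ) else 0) *
      (f w / f o - f v / f o) ^ 2 =
      (∑ v ∈ B, ∑ w ∈ B, (if w ∈ N v then (1 : ℝ) else 0) * ((f w - f v) * (f w - f v))) /
        f o ^ 2 := by
    simp only [Finset.sum_div]
    refine Finset.sum_congr rfl fun v _ => Finset.sum_congr rfl fun w _ => ?_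
    ring
  rw [hscale, div_le_iff₀ (by positivity)]
  rw [div_lt_iff₀ hε] at hfo
  nlinarith

open Classical in
/-- **Liouville's theorem for networks.** On a network whose conductances are at most those of a
recurrent graph, bounded nonnegative subharmonic functions are constant along edges. -/
theorem eq_of_subharmonic (hN : ∀ v w, w ∈ N v ↔ v ∈ N w) (hpos : ∀ v, 0 < (N v).card)
    (hrec : ∀ o, ∀ C : ℝ, ∃ n, C < ∑ k ∈ Finset.range n,
      ((neighborAverage N)^[k] (Pi.single o 1)) o)
    {a : V → V → ℝ} (ha : ∀ v w, a v w = a w v) (ha0 : ∀ v w, w ∈ N v → 0 < a v w)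
    (ha1 : ∀ v w, w ∈ N v → a v w ≤ 1) {t : V → ℝ} {M : ℝ} (ht : ∀ v, 0 ≤ t v)
    (htM : ∀ v, t v ≤ M) (hsub : ∀ v, 0 ≤ ∑ w ∈ N v, a v w * (t w - t v))
    {o p : V} (hp : p ∈ N o) : t p = t o := by
  have key : ∀ ε > 0, a o p * (t p - t o) ^ 2 ≤ 8 * M ^ 2 * ε := by
    intro ε hε
    obtain ⟨φ, hφ, hφo, hE⟩ := exists_energy_le hN hpos o (hrec o) hε
    set B : Finset V := hφ.toFinset ∪ hφ.toFinset.biUnion N with hBdef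
    have hB : ∀ v, φ v ≠ 0 → v ∈ B ∧ N v ⊆ B := fun v hv => by
      have hv' : v ∈ hφ.toFinset := hφ.mem_toFinset.2 hv
      exact ⟨Finset.mem_union_left _ hv',
        (Finset.subset_biUnion_of_mem N hv').trans Finset.subset_union_right⟩
    set b : V → V → ℝ := fun v w => if w ∈ N v then a v w else 0 with hb
    have hb0 : ∀ v w, 0 ≤ b v w := fun v w => by
      simp only [hb]; split_ifs with h
      · exact (ha0 v w h).le
      · exact le_rfl
    have hcac := caccioppoli B (a := b) (fun v w => by simp only [hb, hN v w, ha v w]) hb0 ht htM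
      (φ := φ) fun v _ hv => by
        simp only [hb, ite_mul, zero_mul]
        rw [← Finset.sum_filter, Finset.filter_mem_eq_inter, Finset.inter_eq_right.2 (hB v hv).2]
        exact hsub v
    have hEb : ∑ v ∈ B, ∑ w ∈ B, b v w * (φ w - φ v) ^ 2 ≤ ε := by
      refine le_trans ?_ (hE B hB)
      refine Finset.sum_le_sum fun v _ => Finset.sum_le_sum fun w _ => ?_
      refine mul_le_mul_of_nonneg_right ?_ (sq_nonneg _)
      simp only [hb]; split_ifs with h
      · exact ha1 v w h
      · exact le_rfl
    have ho := hB o (by rw [hφo]; exact one_ne_zero)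
    have hnn : ∀ v w, 0 ≤ b v w * ((φ v ^ 2 + φ w ^ 2) * (t w - t v) ^ 2) := fun v w =>
      mul_nonneg (hb0 v w) (by positivity)
    have h1 : b o p * ((φ o ^ 2 + φ p ^ 2) * (t p - t o) ^ 2) ≤
        ∑ v ∈ B, ∑ w ∈ B, b v w * ((φ v ^ 2 + φ w ^ 2) * (t w - t v) ^ 2) :=
      (Finset.single_le_sum (fun w _ => hnn o w) (ho.2 hp)).trans
        (Finset.single_le_sum (fun v _ => Finset.sum_nonneg fun w _ => hnn v w) ho.1)
    have h2 : a o p * (t p - t o) ^ 2 ≤ b o p * ((φ o ^ 2 + φ p ^ 2) * (t p - t o) ^ 2) := by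
      simp only [hb, if_pos hp, hφo]
      refine mul_le_mul_of_nonneg_left ?_ (ha0 o p hp).le
      nlinarith [mul_nonneg (sq_nonneg (φ p)) (sq_nonneg (t p - t o))]
    have h3 := mul_le_mul_of_nonneg_left hEb (by positivity : 0 ≤ 8 * M ^ 2)
    linarith
  have hle : a o p * (t p - t o) ^ 2 ≤ 0 := by
    refine le_of_forall_pos_le_add fun δ hδ => ?_
    -- The `+ 1` keeps the denominator positive when `M = 0`.
    refine (key (δ / (8 * M ^ 2 + 1)) (by positivity)).trans ?_
    rw [zero_add, mul_div_assoc', div_le_iff₀ (by positivity)]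
    nlinarith [sq_nonneg M]
  have hapos := ha0 o p hp
  have : (t p - t o) ^ 2 = 0 := le_antisymm (by
    by_contra! h
    exact absurd hle (not_le.2 (mul_pos hapos h))) (sq_nonneg _)
  exact sub_eq_zero.1 (pow_eq_zero_iff two_ne_zero |>.1 this)

end Network

-- Angles in triangles of mutually tangent circles

section Angle

/-- At `T = p` and `T = r` the difference of the two sides is `p(q-r)²` and `r(q-p)²`. In between,
it is the linear interpolation of these values plus a nonnegative term. -/
theorem four_mul_mul_le_of_mem_Icc {p q r T : ℝ} (hp : 0 < p) (hq : 0 < q)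
    (hpT : p ≤ T) (hTr : T ≤ r) : 4 * p * q * r ≤ T * (p + q + r - T) ^ 2 := by
  rcases (hpT.trans hTr).eq_or_lt with rfl | hlt
  · obtain rfl : T = p := le_antisymm hTr hpT
    nlinarith [mul_nonneg hp.le (sq_nonneg (T - q))]
  · have e : (T * (p + q + r - T) ^ 2 - 4 * p * q * r) * (r - p) =
        (T - p) * (r * (q - p) ^ 2) + (r - T) * (p * (q - r) ^ 2) +
        (r - p) * ((T - p) * (r - T) * (p + 2 * q + r - T)) := by ring
    have h3 : 0 ≤ (T * (p + q + r - T) ^ 2 - 4 * p * q * r) * (r - p) := by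
      rw [e]
      have := sub_nonneg.2 hpT
      have := sub_nonneg.2 hTr
      have := sub_pos.2 hlt
      have : 0 < r := hp.trans hlt
      have : 0 ≤ p + 2 * q + r - T := by linarith
      positivity
    have := nonneg_of_mul_nonneg_left h3 (sub_pos.2 hlt)
    linarith

/-- Divided by `(x+y+z)³`, this is `4abc ≤ T(a+b+c-T)²` for the weighted mean `T` of `a, b, c`,
which lies between their minimum and maximum. Sorting the three numbers reduces it to the preceding
lemma. -/
theorem four_mul_mul_mul_cube_le {a b c x y z : ℝ} (ha : 0 < a) (hb : 0 < b) (hc : 0 < c)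
    (hx : 0 < x) (hy : 0 < y) (hz : 0 < z) :
    4 * a * b * c * (x + y + z) ^ 3 ≤
      (x * a + y * b + z * c) * ((y + z) * a + (x + z) * b + (x + y) * c) ^ 2 := by
  have aux : ∀ p q r u v w : ℝ, 0 < p → 0 < q → 0 < r → 0 < u → 0 < v → 0 < w → p ≤ q → q ≤ r →
      4 * p * q * r * (u + v + w) ^ 3 ≤
        (u * p + v * q + w * r) * ((v + w) * p + (u + w) * q + (u + v) * r) ^ 2 := by
    intro p q r u v w hp hq hr hu hv hw hpq hqr
    have hS : 0 < u + v + w := by positivity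
    have h := four_mul_mul_le_of_mem_Icc (p := p) (q := q) (r := r)
      (T := (u * p + v * q + w * r) / (u + v + w)) hp hq
      (by rw [le_div_iff₀ hS]
          nlinarith [mul_le_mul_of_nonneg_left hpq hv.le,
            mul_le_mul_of_nonneg_left (hpq.trans hqr) hw.le])
      (by rw [div_le_iff₀ hS]
          nlinarith [mul_le_mul_of_nonneg_left hqr hv.le,
            mul_le_mul_of_nonneg_left (hpq.trans hqr) hu.le])
    have e : (u * p + v * q + w * r) * ((v + w) * p + (u + w) * q + (u + v) * r) ^ 2 =
        (u * p + v * q + w * r) / (u + v + w) *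
          (p + q + r - (u * p + v * q + w * r) / (u + v + w)) ^ 2 * (u + v + w) ^ 3 := by
      field_simp
      ring
    rw [e]
    gcongr
  rcases le_total a b with h1 | h1 <;> rcases le_total b c with h2 | h2 <;>
    rcases le_total a c with h3 | h3
  · linarith [aux a b c x y z ha hb hc hx hy hz h1 h2]
  · linarith [aux a b c x y z ha hb hc hx hy hz h1 h2]
  · linarith [aux a c b x z y ha hc hb hx hz hy h3 h2]
  · linarith [aux c a b z x y hc ha hb hz hx hy h3 h1]
  · linarith [aux b a c y x z hb ha hc hy hx hz h1 h3]
  · linarith [aux b c a y z x hb hc ha hy hz hx h2 h3]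
  · linarith [aux c b a z y x hc hb ha hz hy hx h2 h1]
  · linarith [aux c b a z y x hc hb ha hz hy hx h2 h1]

/-- On the nonnegative half-line `arctan` is concave, so it lies below its tangents. -/
theorem arctan_sub_arctan_le {s u : ℝ} (hs : 0 ≤ s) (hu : 0 ≤ u) :
    Real.arctan u - Real.arctan s ≤ (u - s) / (1 + s ^ 2) := by
  have hd : ∀ x : ℝ, HasDerivAt Real.arctan (1 / (1 + x ^ 2)) x := Real.hasDerivAt_arctan
  rcases lt_trichotomy s u with h | rfl | h
  · obtain ⟨c, hc, hc'⟩ := exists_hasDerivAt_eq_slope Real.arctan _ h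
      Real.continuous_arctan.continuousOn fun x _ => hd x
    rw [eq_div_iff (sub_pos.2 h).ne'] at hc'
    rw [← hc', div_mul_eq_mul_div, one_mul]
    have := hc.1
    gcongr
  · simp
  · obtain ⟨c, hc, hc'⟩ := exists_hasDerivAt_eq_slope Real.arctan _ h
      Real.continuous_arctan.continuousOn fun x _ => hd x
    rw [eq_div_iff (sub_pos.2 h).ne'] at hc'
    have h1 : (s - u) / (1 + s ^ 2) ≤ 1 / (1 + c ^ 2) * (s - u) := by
      rw [div_mul_eq_mul_div, one_mul]
      have := hc.2
      have := hu.trans hc.1.le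
      gcongr
    have h2 : (u - s) / (1 + s ^ 2) = -((s - u) / (1 + s ^ 2)) := by ring
    linarith

/-- The angle at the centre of the circle of radius `r` in the triangle formed by the centres of
mutually tangent circles of radii `r`, `x`, `y`. -/
noncomputable def faceAngle (r x y : ℝ) : ℝ :=
  2 * Real.arctan √(x * y / (r * (r + x + y)))

/-- The inradius of the triangle of centres of mutually tangent circles of radii `r`, `x`, `y`,
divided by the length of its side between the first two. -/
noncomputable def edgeWeight (r x y : ℝ) : ℝ :=
  √(r * x * y / (r + x + y)) / (r + x)

theorem edgeWeight_comm (r x y : ℝ) : edgeWeight r x y = edgeWeight x r y := by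
  rw [edgeWeight, edgeWeight, mul_comm r x, add_comm r x]

theorem edgeWeight_pos {r x y : ℝ} (hr : 0 < r) (hx : 0 < x) (hy : 0 < y) :
    0 < edgeWeight r x y := by
  unfold edgeWeight
  positivity

/-- AM-GM on `r * x`, together with `y ≤ r + x + y`. Two faces meet at each edge, so the
conductances are at most `1`. -/
theorem edgeWeight_le_half {r x y : ℝ} (hr : 0 < r) (hx : 0 < x) (hy : 0 < y) :
    edgeWeight r x y ≤ 1 / 2 := by
  rw [edgeWeight, div_le_iff₀ (by positivity)]
  apply Real.sqrt_le_iff.2 ⟨by positivity, ?_⟩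
  rw [div_le_iff₀ (by positivity)]
  nlinarith [mul_nonneg hy.le (sq_nonneg (r - x)), mul_pos (mul_pos hr hx) hy,
    pow_pos (add_pos hr hx) 3]

/-- The angle is a concave function of the relative radii of the neighbouring circles. -/
theorem mul_faceAngle_sub_le {r x y a b c : ℝ} (hr : 0 < r) (hx : 0 < x) (hy : 0 < y)
    (ha : 0 < a) (hb : 0 < b) (hc : 0 < c) :
    c * (faceAngle (c * r) (a * x) (b * y) - faceAngle r x y) ≤
      edgeWeight r x y * (a - c) + edgeWeight r y x * (b - c) := by
  set S := r + x + y with hS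
  have hS0 : 0 < S := by positivity
  set τ := √(x * y / (r * S)) with hτ
  have hτ0 : 0 < τ := by positivity
  have hτsq : τ ^ 2 = x * y / (r * S) := Real.sq_sqrt (by positivity)
  -- `τ` is the tangent of the half-angle. `τ * K` is affine in `a` and `b`, equals `τ` when `a = b
  -- = c`, and dominates the rescaled half-angle tangent.
  set K := ((y + r) * a + (x + r) * b + (x + y) * c) / (2 * S * c) with hK
  have hK0 : 0 < K := by positivity
  have h1 : √(a * x * (b * y) / (c * r * (c * r + a * x + b * y))) ≤ τ * K := by
    refine Real.sqrt_le_iff.2 ⟨by positivity, ?_⟩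
    rw [mul_pow, hτsq, hK, div_pow, div_mul_div_comm,
      div_le_div_iff₀ (by positivity) (by positivity)]
    have := four_mul_mul_mul_cube_le ha hb hc hx hy hr
    have h' := mul_le_mul_of_nonneg_left this (by positivity : 0 ≤ x * y * r * c)
    calc _ = x * y * r * c * (4 * a * b * c * (x + y + r) ^ 3) := by rw [hS]; ring
      _ ≤ _ := h'
      _ = _ := by ring
  have h2 := arctan_sub_arctan_le hτ0.le (Real.sqrt_nonneg
    (a * x * (b * y) / (c * r * (c * r + a * x + b * y))))
  have hτ1 : 1 + τ ^ 2 = (r + x) * (r + y) / (r * S) := by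
    rw [hτsq, hS]; field_simp; ring
  have hρ : √(r * x * y / S) = r * τ := by
    rw [Real.sqrt_eq_iff_mul_self_eq (by positivity) (by positivity)]
    have : r * τ * (r * τ) = r ^ 2 * τ ^ 2 := by ring
    rw [this, hτsq]
    field_simp
  have hρ' : √(r * y * x / (r + y + x)) = r * τ := by
    rw [← hρ, hS]; congr 2 <;> ring
  have h3 : (√(a * x * (b * y) / (c * r * (c * r + a * x + b * y))) - τ) / (1 + τ ^ 2) ≤
      (τ * K - τ) / (1 + τ ^ 2) := by gcongr
  have h4 : c * (2 * ((τ * K - τ) / (1 + τ ^ 2))) =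
      edgeWeight r x y * (a - c) + edgeWeight r y x * (b - c) := by
    rw [edgeWeight, edgeWeight, ← hS, hρ, hρ', hτ1, hK, hS]
    field_simp
    ring
  rw [← h4, faceAngle, faceAngle, ← mul_sub]
  gcongr
  exact h2.trans h3

theorem faceAngle_pos {r x y : ℝ} (hr : 0 < r) (hx : 0 < x) (hy : 0 < y) :
    0 < faceAngle r x y := by
  have : 0 < Real.arctan √(x * y / (r * (r + x + y))) := Real.arctan_pos.2 (by positivity)
  unfold faceAngle
  positivity

theorem faceAngle_lt_pi (r x y : ℝ) : faceAngle r x y < Real.pi := by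
  have := Real.arctan_lt_pi_div_two √(x * y / (r * (r + x + y)))
  unfold faceAngle
  linarith

theorem cos_faceAngle {r x y : ℝ} (hr : 0 < r) (hx : 0 < x) (hy : 0 < y) :
    Real.cos (faceAngle r x y) = 1 - 2 * (x * y) / ((r + x) * (r + y)) := by
  rw [faceAngle, Real.cos_two_mul, Real.cos_sq_arctan, Real.sq_sqrt (by positivity)]
  field_simp
  ring

/-- The law of cosines determines the cosine of the angle from `a` to `b`, and the orientation fixes
the sign of its sine. -/
theorem eq_mul_exp_faceAngle {r x y : ℝ} (hr : 0 < r) (hx : 0 < x) (hy : 0 < y) {a b : ℂ}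
    (ha : ‖a‖ = r + x) (hb : ‖b‖ = r + y) (hab : ‖a - b‖ = x + y)
    (him : 0 < ((starRingEnd ℂ) a * b).im) :
    b = a * ((r + y) / (r + x) : ℝ) * Complex.exp (faceAngle r x y * Complex.I) := by
  set α := faceAngle r x y with hα
  have hsin : 0 < Real.sin α :=
    Real.sin_pos_of_pos_of_lt_pi (faceAngle_pos hr hx hy) (faceAngle_lt_pi r x y)
  have hrx : 0 < r + x := by positivity
  have hry : 0 < r + y := by positivity
  have hcos := cos_faceAngle hr hx hy
  rw [← hα] at hcos
  have ha2 : a.re * a.re + a.im * a.im = (r + x) ^ 2 := by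
    rw [← ha, ← Complex.normSq_eq_norm_sq, Complex.normSq_apply]
  have hb2 : b.re * b.re + b.im * b.im = (r + y) ^ 2 := by
    rw [← hb, ← Complex.normSq_eq_norm_sq, Complex.normSq_apply]
  have hab2 : (a.re - b.re) * (a.re - b.re) + (a.im - b.im) * (a.im - b.im) = (x + y) ^ 2 := by
    rw [← hab, ← Complex.normSq_eq_norm_sq, Complex.normSq_apply, Complex.sub_re, Complex.sub_im]
  have hre : ((starRingEnd ℂ) a * b).re = (r + x) * (r + y) * Real.cos α := by
    rw [hcos]
    field_simp
    simp only [Complex.mul_re, Complex.conj_re, Complex.conj_im]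
    linarith
  have him' : ((starRingEnd ℂ) a * b).im = (r + x) * (r + y) * Real.sin α := by
    refine (sq_eq_sq₀ him.le (by positivity)).1 ?_
    have h1 : ((starRingEnd ℂ) a * b).re ^ 2 + ((starRingEnd ℂ) a * b).im ^ 2 =
        ((r + x) * (r + y)) ^ 2 := by
      simp only [Complex.mul_re, Complex.mul_im, Complex.conj_re, Complex.conj_im]
      rw [mul_pow, ← ha2, ← hb2]
      ring
    rw [hre] at h1
    have := Real.sin_sq_add_cos_sq α
    calc _ = ((r + x) * (r + y)) ^ 2 * (1 - Real.cos α ^ 2) := by linarith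
      _ = _ := by rw [← this]; ring
  have hz : (starRingEnd ℂ) a * b =
      (((r + x) * (r + y) : ℝ) : ℂ) * Complex.exp (α * Complex.I) := by
    apply Complex.ext
    · rw [Complex.re_ofReal_mul, Complex.exp_ofReal_mul_I_re, hre]
    · rw [Complex.im_ofReal_mul, Complex.exp_ofReal_mul_I_im, him']
  have haa : a * (starRingEnd ℂ) a = (((r + x) ^ 2 : ℝ) : ℂ) := by
    rw [Complex.mul_conj, Complex.normSq_eq_norm_sq, ha]
  have hne : (((r + x) ^ 2 : ℝ) : ℂ) ≠ 0 := by
    exact_mod_cast (pow_pos hrx 2).ne'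
  apply mul_left_cancel₀ hne
  rw [← haa, mul_assoc, hz, haa]
  have hne' : ((r : ℂ) + x) ≠ 0 := by exact_mod_cast hrx.ne'
  push_cast
  field_simp

end Angle

-- Angle sums around a vertex

namespace OrientedTriangulation

variable {V : Type*} (K : OrientedTriangulation V)

theorem pos_unique {u v w x : V} (h : K.pos u v w) (h' : K.pos u v x) : w = x := by
  obtain ⟨n, -, c, hc, hcyc⟩ := K.link_cycle u
  obtain ⟨i, rfl, rfl⟩ := (hcyc v w).1 h
  obtain ⟨j, hij, rfl⟩ := (hcyc _ x).1 h'
  rw [hc hij]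

open Classical in
/-- The vertex completing the directed edge from `u` to `v` to a positively oriented face. -/
noncomputable def third (u v : V) : V :=
  if h : ∃ w, K.pos u v w then h.choose else u

theorem third_eq {u v w : V} (h : K.pos u v w) : K.third u v = w := by
  have h' : ∃ w, K.pos u v w := ⟨w, h⟩
  rw [third, dif_pos h']
  exact K.pos_unique h'.choose_spec h

end OrientedTriangulation

namespace CirclePacking

variable {V : Type*} {K : OrientedTriangulation V} (P : CirclePacking K)

theorem center_sub_eq_mul_exp {u v w : V} (h : K.pos u v w) :
    P.center w - P.center u = (P.center v - P.center u) *
      ((P.radius u + P.radius w) / (P.radius u + P.radius v) : ℝ) *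
      Complex.exp (faceAngle (P.radius u) (P.radius v) (P.radius w) * Complex.I) := by
  refine eq_mul_exp_faceAngle (P.radius_pos u) (P.radius_pos v) (P.radius_pos w) ?_ ?_ ?_
    (P.oriented u v w h)
  · rw [← dist_eq_norm, dist_comm, P.tangent u v w h]
  · rw [← dist_eq_norm, P.tangent w u v (K.pos_rotate _ _ _ (K.pos_rotate _ _ _ h)), add_comm]
  · rw [sub_sub_sub_cancel_right, ← dist_eq_norm, P.tangent v w u (K.pos_rotate _ _ _ h)]

/-- The total angle at the centre of `v` over the first `k` faces of a fan `w 0, w 1, …`. -/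
noncomputable def fanAngle (v : V) (w : ℕ → V) (k : ℕ) : ℝ :=
  ∑ j ∈ Finset.range k, faceAngle (P.radius v) (P.radius (w j)) (P.radius (w (j + 1)))

/-- Successive rotations compose by adding angles. Univalence is not needed, so this also covers
branched packings. -/
theorem center_fan_sub {v : V} {w : ℕ → V} (hw : ∀ k, K.pos v (w k) (w (k + 1))) (k : ℕ) :
    P.center (w k) - P.center v = (P.center (w 0) - P.center v) *
      ((P.radius v + P.radius (w k)) / (P.radius v + P.radius (w 0)) : ℝ) *
      Complex.exp (P.fanAngle v w k * Complex.I) := by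
  have hpos : ∀ k, (P.radius v : ℂ) + P.radius (w k) ≠ 0 := fun k => by
    exact_mod_cast (add_pos (P.radius_pos v) (P.radius_pos (w k))).ne'
  induction k with
  | zero =>
    have := hpos 0
    simp [fanAngle, div_self this]
  | succ k ih =>
    have h0 := hpos 0
    have hk := hpos k
    rw [P.center_sub_eq_mul_exp (hw k), ih, fanAngle, fanAngle, Finset.sum_range_succ]
    push_cast
    rw [add_mul, Complex.exp_add]
    field_simp

theorem fanAngle_pos (v : V) (w : ℕ → V) {k : ℕ} (hk : k ≠ 0) : 0 < P.fanAngle v w k :=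
  Finset.sum_pos (fun _ _ => faceAngle_pos (P.radius_pos _) (P.radius_pos _) (P.radius_pos _))
    (Finset.nonempty_range_iff.2 hk)

/-- The angles around a vertex add up to at least `2π` since its link closes up. -/
theorem two_pi_le_fanAngle {v : V} {w : ℕ → V} (hw : ∀ k, K.pos v (w k) (w (k + 1))) {n : ℕ}
    (hn : n ≠ 0) (hclose : w n = w 0) : 2 * Real.pi ≤ P.fanAngle v w n := by
  have h := P.center_fan_sub hw n
  have h0 : (P.radius v : ℂ) + P.radius (w 0) ≠ 0 := by
    exact_mod_cast (add_pos (P.radius_pos v) (P.radius_pos (w 0))).ne'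
  have hne : P.center (w 0) - P.center v ≠ 0 := by
    rw [sub_ne_zero, ← dist_pos, dist_comm, P.tangent _ _ _ (hw 0)]
    exact add_pos (P.radius_pos v) (P.radius_pos (w 0))
  rw [hclose] at h
  have h1 : Complex.exp (P.fanAngle v w n * Complex.I) = 1 := by
    apply mul_left_cancel₀ hne
    push_cast at h
    rw [div_self h0, mul_one] at h
    rw [← h, mul_one]
  obtain ⟨m, hm⟩ := Complex.exp_eq_one_iff.1 h1
  have h2 : P.fanAngle v w n = m * (2 * Real.pi) := by
    have : (P.fanAngle v w n : ℂ) = ((m * (2 * Real.pi) : ℝ) : ℂ) := by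
      apply mul_right_cancel₀ Complex.I_ne_zero
      rw [hm]
      push_cast
      ring
    exact_mod_cast this
  have h3 := P.fanAngle_pos v w hn
  rw [h2] at h3 ⊢
  have hm0 : 0 < m := by
    by_contra! hm0
    have : (m : ℝ) ≤ 0 := by exact_mod_cast hm0
    nlinarith [Real.pi_pos]
  have : (1 : ℝ) ≤ m := by exact_mod_cast hm0
  nlinarith [Real.pi_pos]

variable {P}

/-- In a univalent packing the angles around a vertex add up to at most `2π`: otherwise the
largest neighbouring circle would reappear between two smaller consecutive ones. -/
theorem Univalent.fanAngle_le_two_pi (hP : P.Univalent) {v : V} {w : ℕ → V}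
    (hw : ∀ k, K.pos v (w k) (w (k + 1))) {n : ℕ} (hinj : ∀ k < n, k ≠ 0 → w k ≠ w 0)
    (hmax : ∀ k, P.radius (w k) ≤ P.radius (w 0)) : P.fanAngle v w n ≤ 2 * Real.pi := by
  classical
  by_contra! hlt
  -- Take the first face at which the accumulated angle passes `2π`. Its sector, from `w i` to `w (i
  -- + 1)`, contains the direction of `w 0`.
  have hex : ∃ k, 2 * Real.pi < P.fanAngle v w k := ⟨n, hlt⟩
  obtain ⟨i, hi⟩ : ∃ i, Nat.find hex = i + 1 := Nat.exists_eq_succ_of_ne_zero fun h0 => by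
    have := Nat.find_spec hex
    rw [h0, fanAngle, Finset.sum_range_zero] at this
    linarith [Real.pi_pos]
  have hlt' : 2 * Real.pi < P.fanAngle v w (i + 1) := hi ▸ Nat.find_spec hex
  have hle : P.fanAngle v w i ≤ 2 * Real.pi := not_lt.1 (Nat.find_min hex (by omega))
  have hin : i < n := by
    have := Nat.find_min' hex hlt
    omega
  set r := P.radius v with hr
  have hr0 : 0 < r := P.radius_pos v
  have hrad : ∀ k, 0 < P.radius (w k) := fun k => P.radius_pos _
  have hstep : P.fanAngle v w (i + 1) =
      P.fanAngle v w i + faceAngle r (P.radius (w i)) (P.radius (w (i + 1))) :=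
    Finset.sum_range_succ _ _
  have hpi := faceAngle_lt_pi r (P.radius (w i)) (P.radius (w (i + 1)))
  have hi0 : i ≠ 0 := by
    rintro rfl
    rw [hstep, fanAngle, Finset.sum_range_zero, zero_add] at hlt'
    linarith [Real.pi_pos]
  have hcos : Real.cos (faceAngle r (P.radius (w i)) (P.radius (w (i + 1)))) <
      Real.cos (P.fanAngle v w i) := by
    rw [← Real.cos_two_pi_sub (P.fanAngle v w i)]
    exact Real.cos_lt_cos_of_nonneg_of_le_pi (by linarith) hpi.le (by linarith)
  rw [cos_faceAngle hr0 (hrad _) (hrad _)] at hcos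
  have hdist := (disjoint_ball_ball_iff (hrad i) (hrad 0)).1 (hP _ _ (hinj i hin hi0))
  have hnorm : ‖P.center (w 0) - P.center v‖ = r + P.radius (w 0) := by
    rw [← dist_eq_norm, dist_comm, P.tangent _ _ _ (hw 0)]
  have hR0 : 0 < r + P.radius (w 0) := add_pos hr0 (hrad 0)
  have hRi : 0 < r + P.radius (w i) := add_pos hr0 (hrad i)
  have hsq : dist (P.center (w i)) (P.center (w 0)) ^ 2 =
      (r + P.radius (w i)) ^ 2 + (r + P.radius (w 0)) ^ 2 -
        2 * (r + P.radius (w i)) * (r + P.radius (w 0)) * Real.cos (P.fanAngle v w i) := by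
    set θ := P.fanAngle v w i
    have h1 : P.center (w i) - P.center (w 0) = (P.center (w 0) - P.center v) *
        (((r + P.radius (w i)) / (r + P.radius (w 0)) : ℝ) * Complex.exp (θ * Complex.I) - 1) := by
      rw [mul_sub, ← mul_assoc, ← P.center_fan_sub hw i]
      ring
    rw [dist_eq_norm, h1, norm_mul, hnorm, mul_pow, ← Complex.normSq_eq_norm_sq,
      Complex.normSq_apply, Complex.sub_re, Complex.sub_im, Complex.re_ofReal_mul,
      Complex.im_ofReal_mul, Complex.exp_ofReal_mul_I_re, Complex.exp_ofReal_mul_I_im,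
      Complex.one_re, Complex.one_im]
    have := Real.sin_sq_add_cos_sq θ
    have hs : Real.sin θ ^ 2 = 1 - Real.cos θ ^ 2 := by linarith
    field_simp
    ring_nf
    rw [hs]
    ring
  have h2 : (P.radius (w i) + P.radius (w 0)) ^ 2 ≤
      dist (P.center (w i)) (P.center (w 0)) ^ 2 := by
    have := hrad i
    have := hrad 0
    gcongr
  rw [hsq] at h2
  -- The angle at `v` grows with the radius of the outer circle. Tangency of `w 0` to `w i` would
  -- thus need at least the angle from `w i` to `w (i + 1)`, while the available angle is smaller:
  -- the circles would overlap.
  have h3 : 2 * (P.radius (w i) * P.radius (w (i + 1))) /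
      ((r + P.radius (w i)) * (r + P.radius (w (i + 1)))) ≤
      2 * (P.radius (w i) * P.radius (w 0)) / ((r + P.radius (w i)) * (r + P.radius (w 0))) := by
    rw [div_le_div_iff₀ (mul_pos hRi (add_pos hr0 (hrad _))) (mul_pos hRi hR0)]
    have := mul_le_mul_of_nonneg_left (hmax (i + 1))
      (mul_pos (mul_pos (hrad i) hRi) hr0).le
    nlinarith
  have h4 : 1 - 2 * (P.radius (w i) * P.radius (w 0)) /
      ((r + P.radius (w i)) * (r + P.radius (w 0))) < Real.cos (P.fanAngle v w i) := by linarith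
  rw [sub_lt_comm, lt_div_iff₀ (mul_pos hRi hR0)] at h4
  nlinarith

end CirclePacking

-- Subharmonicity of the ratio of radii

theorem sum_range_natCast_zmod {n : ℕ} [NeZero n] (g : ZMod n → ℝ) :
    ∑ j ∈ Finset.range n, g (j : ZMod n) = ∑ i, g i := by
  refine Finset.sum_nbij' (fun j => (j : ZMod n)) ZMod.val (by simp)
    (fun i _ => Finset.mem_range.2 (ZMod.val_lt i)) ?_ ?_ ?_
  · intro j hj
    exact ZMod.val_cast_of_lt (Finset.mem_range.1 hj)
  · intro i _
    exact ZMod.natCast_zmod_val i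
  · simp

namespace CirclePacking

variable {V : Type*} {K : OrientedTriangulation V} {P : CirclePacking K}

/-- The starting point `s` is free, so the fan can begin at the largest neighbour for the upper
bound. -/
theorem fanAngle_zmod (P : CirclePacking K) {n : ℕ} [NeZero n] (v : V) (c : ZMod n → V)
    (s : ZMod n) : P.fanAngle v (fun k => c (s + k)) n =
      ∑ i, faceAngle (P.radius v) (P.radius (c i)) (P.radius (c (i + 1))) := by
  rw [fanAngle, ← Equiv.sum_comp (Equiv.addLeft s), ← sum_range_natCast_zmod]
  refine Finset.sum_congr rfl fun j _ => ?_
  simp [add_assoc]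

theorem two_pi_le_sum_faceAngle (P : CirclePacking K) {n : ℕ} [NeZero n] {v : V} {c : ZMod n → V}
    (hc : ∀ i, K.pos v (c i) (c (i + 1))) :
    2 * Real.pi ≤ ∑ i, faceAngle (P.radius v) (P.radius (c i)) (P.radius (c (i + 1))) := by
  rw [← P.fanAngle_zmod v c 0]
  refine P.two_pi_le_fanAngle (fun k => ?_) (NeZero.ne n) (by simp)
  have := hc (0 + k)
  rwa [add_assoc, ← Nat.cast_add_one] at this

theorem Univalent.sum_faceAngle_le (hP : P.Univalent) {n : ℕ} [NeZero n] {v : V}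
    {c : ZMod n → V} (hinj : Function.Injective c) (hc : ∀ i, K.pos v (c i) (c (i + 1))) :
    ∑ i, faceAngle (P.radius v) (P.radius (c i)) (P.radius (c (i + 1))) ≤ 2 * Real.pi := by
  obtain ⟨s, -, hs⟩ := Finset.exists_max_image Finset.univ (fun i => P.radius (c i))
    Finset.univ_nonempty
  rw [← P.fanAngle_zmod v c s]
  refine hP.fanAngle_le_two_pi (fun k => ?_) (fun k hk hk0 h => hk0 ?_) (fun k => ?_)
  · have := hc (s + k)
    rwa [add_assoc, ← Nat.cast_add_one] at this
  · have h1 := hinj h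
    rw [add_right_inj, Nat.cast_zero, ZMod.natCast_eq_zero_iff] at h1
    exact Nat.eq_zero_of_dvd_of_lt h1 hk
  · simpa using hs (s + k) (Finset.mem_univ _)

/-- The conductances of the network on the 1-skeleton for which ratio maps are subharmonic. -/
noncomputable def conductance (P : CirclePacking K) (v w : V) : ℝ :=
  edgeWeight (P.radius v) (P.radius w) (P.radius (K.third v w)) +
    edgeWeight (P.radius w) (P.radius v) (P.radius (K.third w v))

theorem conductance_comm (P : CirclePacking K) (v w : V) :
    P.conductance v w = P.conductance w v :=
  add_comm _ _

theorem conductance_pos (P : CirclePacking K) (v w : V) : 0 < P.conductance v w :=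
  add_pos (edgeWeight_pos (P.radius_pos _) (P.radius_pos _) (P.radius_pos _))
    (edgeWeight_pos (P.radius_pos _) (P.radius_pos _) (P.radius_pos _))

theorem conductance_le_one (P : CirclePacking K) (v w : V) : P.conductance v w ≤ 1 := by
  have h1 := edgeWeight_le_half (P.radius_pos v) (P.radius_pos w) (P.radius_pos (K.third v w))
  have h2 := edgeWeight_le_half (P.radius_pos w) (P.radius_pos v) (P.radius_pos (K.third w v))
  rw [conductance]
  linarith

/-- The ratio of radii from a univalent packing to any other packing is subharmonic. -/
theorem Univalent.ratio_subharmonic (hP : P.Univalent) (Q : CirclePacking K) (v : V) :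
    0 ≤ ∑ w ∈ K.nbrs v, P.conductance v w *
      (Q.radius w / P.radius w - Q.radius v / P.radius v) := by
  classical
  obtain ⟨n, hn, c, hinj, hcyc⟩ := K.link_cycle v
  have : NeZero n := ⟨by omega⟩
  have hc : ∀ i, K.pos v (c i) (c (i + 1)) := fun i => (hcyc _ _).2 ⟨i, rfl, rfl⟩
  have hnbrs : K.nbrs v = Finset.univ.image c := by
    ext w
    rw [K.mem_nbrs]
    constructor
    · rintro ⟨x, hx⟩
      obtain ⟨i, rfl, -⟩ := (hcyc _ _).1 hx
      exact Finset.mem_image_of_mem _ (Finset.mem_univ _)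
    · intro hw
      obtain ⟨i, -, rfl⟩ := Finset.mem_image.1 hw
      exact ⟨_, hc i⟩
  have hthird : ∀ i, K.third v (c i) = c (i + 1) := fun i => K.third_eq (hc i)
  have hthird' : ∀ i, K.third (c (i + 1)) v = c i := fun i =>
    K.third_eq (K.pos_rotate _ _ _ (K.pos_rotate _ _ _ (hc i)))
  set t : V → ℝ := fun w => Q.radius w / P.radius w with ht
  have ht0 : ∀ w, 0 < t w := fun w => div_pos (Q.radius_pos w) (P.radius_pos w)
  have htQ : ∀ w, t w * P.radius w = Q.radius w := fun w =>
    div_mul_cancel₀ _ (P.radius_pos w).ne'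
  change 0 ≤ ∑ w ∈ K.nbrs v, P.conductance v w * (t w - t v)
  rw [hnbrs, Finset.sum_image fun i _ j _ h => hinj h]
  -- Regroup by faces: each conductance is a sum over the two faces at its edge, and a cyclic shift
  -- matches the second contribution with the preceding face.
  have hsplit : ∑ i, P.conductance v (c i) * (t (c i) - t v) =
      ∑ i, (edgeWeight (P.radius v) (P.radius (c i)) (P.radius (c (i + 1))) * (t (c i) - t v) +
        edgeWeight (P.radius v) (P.radius (c (i + 1))) (P.radius (c i)) *
          (t (c (i + 1)) - t v)) := by
    simp only [conductance, add_mul, Finset.sum_add_distrib, hthird]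
    congr 1
    rw [← Equiv.sum_comp (Equiv.addRight (1 : ZMod n))]
    refine Finset.sum_congr rfl fun i _ => ?_
    simp only [Equiv.coe_addRight]
    rw [hthird', edgeWeight_comm]
  rw [hsplit]
  have hle := Finset.sum_le_sum fun i (_ : i ∈ Finset.univ) =>
    mul_faceAngle_sub_le (P.radius_pos v) (P.radius_pos (c i)) (P.radius_pos (c (i + 1)))
      (ht0 (c i)) (ht0 (c (i + 1))) (ht0 v)
  refine le_trans ?_ hle
  rw [← Finset.mul_sum]
  refine mul_nonneg (ht0 v).le ?_
  simp only [htQ, Finset.sum_sub_distrib]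
  linarith [Q.two_pi_le_sum_faceAngle hc, hP.sum_faceAngle_le hinj hc]

theorem exists_ratioMap_eq (P Q : CirclePacking K) (v : V) :
    ∃ x, P.ratioMap Q x = Q.radius v / P.radius v := by
  obtain ⟨w, x, h⟩ := K.neighborSet_nonempty v
  refine ⟨⟨Finsupp.single v 1, fun u => ?_, by simp, v, w, x, h, ?_⟩, by simp [ratioMap]⟩
  · classical
    rw [Finsupp.single_apply]
    split_ifs <;> norm_num
  · exact (Finset.coe_subset.2 Finsupp.support_single_subset).trans (by simp)

end CirclePacking

-- Constancy of the ratio map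

theorem corollary3p3 {V : Type*} (K : OrientedTriangulation V) (hK : K.Recurrent)
    (P : CirclePacking K) (hP : P.Univalent) (hcarr : P.carrier = Set.univ)
    (Q : CirclePacking K) :
    ¬ BddAbove (Set.range (P.ratioMap Q)) ∨ ∃ c : ℝ, ∀ x, P.ratioMap Q x = c := by
  refine or_iff_not_imp_left.2 fun hbdd => ?_
  obtain ⟨M, hM⟩ := not_not.1 hbdd
  have hedge : ∀ u v, v ∈ K.nbrs u → Q.radius v / P.radius v = Q.radius u / P.radius u :=
    fun u v h => eq_of_subharmonic (t := fun v => Q.radius v / P.radius v) (M := M)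
      (fun _ _ => K.mem_nbrs_comm) K.card_nbrs_pos hK.exists_lt_sum P.conductance_comm
      (fun _ _ _ => P.conductance_pos _ _) (fun _ _ _ => P.conductance_le_one _ _)
      (fun v => (div_pos (Q.radius_pos v) (P.radius_pos v)).le)
      (fun v => by
        obtain ⟨x, hx⟩ := P.exists_ratioMap_eq Q v
        exact hx ▸ hM ⟨x, rfl⟩)
      (hP.ratio_subharmonic Q) h
  have hconst : ∀ u v, Q.radius v / P.radius v = Q.radius u / P.radius u := fun u v => by
    induction K.connected u v with
    | refl => rfl
    | tail _ h ih => rw [hedge _ _ (K.mem_nbrs.2 h), ih]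
  -- A point of the nonempty carrier supplies a vertex, whose ratio is the constant.
  obtain ⟨x₀, -⟩ : (0 : ℂ) ∈ P.carrier := hcarr ▸ Set.mem_univ _
  obtain ⟨o, -⟩ : x₀.1.support.Nonempty := by
    rw [Finset.nonempty_iff_ne_empty]
    intro h
    have := x₀.2.2.1
    rw [Finsupp.sum, h, Finset.sum_empty] at this
    exact zero_ne_one this
  refine ⟨Q.radius o / P.radius o, fun x => ?_⟩
  rw [CirclePacking.ratioMap, Finsupp.sum]
  simp_rw [hconst o]
  rw [← Finset.sum_mul]
  have := x.2.2.1
  rw [Finsupp.sum] at this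
  rw [this, one_mul]
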